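/- Consider the binary symmetric channel with word length $n\ge 1$ and at most one transmission error. A strategy with $k$ feedbacks ($0\le k\le n-1$) for $M$ messages divides the word length into $k+1$ nonempty consecutive blocks, $n=n_1+\dots+n_{k+1}$; the $i$-th transmitted block is a function of the message and of the $n_1+\dots+n_{i-1}$ symbols received before it, which the encoder learns without error through the feedback channel. The case $k=n-1$ is called complete feedback. The cloud of a message is the set of binary sequences of length $n$ that can be received, with at most one error, when this message is transmitted. One says that $M$ messages can be transmitted with $k$ feedbacks and a single error if there is a strategy with $k$ feedbacks for $M$ messages whose clouds are pairwise disjoint. Let $$U(n)=2\left\lfloor\frac{2^n}{2(n+1)}\right\rfloor,\qquad r(n)=2^n-(n+1)U(n),\qquad M_{\rm ad}(n)=\begin{cases}U(n)&\text{if } r(n)<2n,\\ U(n)+1&\text{if } r(n)\ge 2n.\end{cases}$$ **Theorem.** For every $n\ge 1$, $M_{\rm ad}(n)$ is the maximum number of messages that can be transmitted with complete feedback and a single error. For every $n\ge 3$, $M_{\rm ad}(n)$ messages can be transmitted with only two feedbacks and a single error, i.e., the same number as with complete feedback. (For $n\le 2$, complete feedback itself uses fewer than two feedbacks.) -/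

import Mathlib

/-- A transmission strategy for `M` messages over a binary channel with word length `n` and `k`
feedbacks.  The word length is divided into `k + 1` nonempty consecutive blocks.
`enc m y` is the sequence that the encoder feeds into the channel when the message is `m` and the
channel output is `y`.  By `causal`, the block number `i` of the transmitted sequence is a function
only of the message and of the output symbols received before that block starts; in particular
the first block depends on the message only. -/
structure FeedbackStrategy (k n M : ℕ) where
  /-- the block lengths `n₁, …, n_{k+1}` -/
  len : Fin (k + 1) → ℕ
  len_pos : ∀ i, 0 < len i
  sum_len : ∑ i, len i = n
  /-- the transmitted sequence, given the message and the received sequence -/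
  enc : Fin M → (Fin n → Bool) → (Fin n → Bool)
  causal : ∀ (m : Fin M) (i : Fin (k + 1)) (y y' : Fin n → Bool),
    (∀ l : Fin n, (l : ℕ) < ∑ a with a < i, len a → y l = y' l) →
    ∀ j : Fin n, ∑ a with a < i, len a ≤ (j : ℕ) → (j : ℕ) < ∑ a with a ≤ i, len a →
      enc m y j = enc m y' j

/-- The cloud `B_t(m)`: the sequences `y` that can be received, in the binary symmetric channel with
at most `t` errors, when the message `m` is transmitted.  When `y` is received, the transmitted
sequence was `S.enc m y`, and the errors are the positions where the two differ. -/
def FeedbackStrategy.cloud {k n M : ℕ} (S : FeedbackStrategy k n M) (t : ℕ) (m : Fin M) :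
    Set (Fin n → Bool) :=
  {y | hammingDist (S.enc m y) y ≤ t}

/-- The strategy corrects `t` errors: the clouds of distinct messages are disjoint. -/
def FeedbackStrategy.Corrects {k n M : ℕ} (S : FeedbackStrategy k n M) (t : ℕ) : Prop :=
  ∀ m m' : Fin M, m ≠ m' → Disjoint (S.cloud t m) (S.cloud t m')

/-- `M` messages can be transmitted over the binary symmetric channel with word length `n`,
`k` feedbacks and at most `t` errors. -/
def CanTransmit (k n t M : ℕ) : Prop :=
  ∃ S : FeedbackStrategy k n M, S.Corrects t

/-- `U(n) = 2 ⌊2^n / (2(n+1))⌋`. -/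
def evenHamming (n : ℕ) : ℕ := 2 * (2 ^ n / (2 * (n + 1)))

/-- `r(n) = 2^n - (n+1) U(n)`; the subtraction does not truncate, see
`succ_mul_evenHamming_le`. -/
def hammingRest (n : ℕ) : ℕ := 2 ^ n - (n + 1) * evenHamming n

theorem succ_mul_evenHamming_le (n : ℕ) : (n + 1) * evenHamming n ≤ 2 ^ n := by
  have h := Nat.mul_div_le (2 ^ n) (2 * (n + 1))
  calc (n + 1) * evenHamming n = 2 * (n + 1) * (2 ^ n / (2 * (n + 1))) := by
        unfold evenHamming; ring
    _ ≤ 2 ^ n := h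

/-- The number `M_ad(n)`. -/
def Mad (n : ℕ) : ℕ :=
  if hammingRest n < 2 * n then evenHamming n else evenHamming n + 1

/-! Upper bound. Let the first received bit be `b`. A message whose first transmitted bit is `b` may
still suffer an error in any of the `n - 1` later bits, so its cloud has `n` words in this half of
the cube; any other message has used up its error and has one word there. Thus `M + a * (n - 1) ≤ 2
^ (n - 1)` if `a` messages start with `b`. Using this for both values of `b` gives `M ≤ Mad n`
(`half_volume_bound`, `le_Mad_of_half_volume`).

Construction. The first block is one bit that splits the messages evenly. The second block, of
length `p`, spreads the messages without error so far almost evenly over its words, and those with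
one error fill up the remaining room. In the last block, of length `q`, the messages without error
use a shortened Hamming code and the others use words outside its balls (`exists_lastTwoBlocks`,
`exists_lastBlock`). The total volume fits by `Mad_half_volume`; it remains to choose `p`, `q` and
the loads `s y` so that the volume fits for each received `y`. -/

/-! ### Words at distance one and single-error-correcting codes. -/

/-- The word `x` with its bit number `j` inverted. -/
def flipBit {n : ℕ} (x : Fin n → Bool) (j : Fin n) : Fin n → Bool :=
  Function.update x j (!x j)

theorem flipBit_flipBit {n : ℕ} (x : Fin n → Bool) (j : Fin n) :
    flipBit (flipBit x j) j = x := by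
  simp [flipBit]

theorem flipBit_involutive {n : ℕ} (j : Fin n) :
    Function.Involutive fun x : Fin n → Bool => flipBit x j :=
  fun x => flipBit_flipBit x j

theorem exists_eq_flipBit_of_hammingDist_eq_one {n : ℕ} {x y : Fin n → Bool}
    (h : hammingDist x y = 1) : ∃ j, y = flipBit x j := by
  obtain ⟨j, hj⟩ := Finset.card_eq_one.mp h
  refine ⟨j, funext fun i => ?_⟩
  have hi := Finset.ext_iff.mp hj i
  simp only [Finset.mem_filter, Finset.mem_univ, true_and, Finset.mem_singleton] at hi
  by_cases hij : i = j
  · subst hij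
    have := hi.mpr rfl
    simp only [flipBit, Function.update_self]
    revert this
    cases x i <;> cases y i <;> simp
  · simp only [flipBit, Function.update_of_ne hij]
    by_contra hne
    exact hij (hi.mp (Ne.symm hne))

/-- The words of the ball of radius one, indexed by the position of the error, if any. -/
def flipBit? {n : ℕ} (x : Fin n → Bool) : Option (Fin n) → Fin n → Bool
  | none => x
  | some j => flipBit x j

theorem flipBit?_injective {n : ℕ} (o : Option (Fin n)) :
    Function.Injective fun x : Fin n → Bool => flipBit? x o := by
  cases o with
  | none => exact fun _ _ h => h
  | some j => exact (flipBit_involutive j).injective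

theorem exists_eq_flipBit?_of_hammingDist_le_one {n : ℕ} {x y : Fin n → Bool}
    (h : hammingDist x y ≤ 1) : ∃ o, y = flipBit? x o := by
  rcases Nat.le_one_iff_eq_zero_or_eq_one.mp h with h | h
  · exact ⟨none, (hammingDist_eq_zero.mp h).symm⟩
  · obtain ⟨j, hj⟩ := exists_eq_flipBit_of_hammingDist_eq_one h
    exact ⟨some j, hj⟩

theorem card_hammingBall_one_le {n : ℕ} (x : Fin n → Bool) :
    (Finset.univ.filter fun y => hammingDist x y ≤ 1).card ≤ n + 1 := by
  have hsub : (Finset.univ.filter fun y => hammingDist x y ≤ 1) ⊆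
      Finset.univ.image (flipBit? x) := by
    intro y hy
    obtain ⟨o, ho⟩ := exists_eq_flipBit?_of_hammingDist_le_one (Finset.mem_filter.mp hy).2
    exact Finset.mem_image.mpr ⟨o, Finset.mem_univ _, ho.symm⟩
  calc _ ≤ _ := Finset.card_le_card hsub
    _ ≤ _ := Finset.card_image_le
    _ = n + 1 := by simp

/-- A set of words corrects one error if its balls of radius one are disjoint. -/
def CorrectsOne {n : ℕ} (C : Finset (Fin n → Bool)) : Prop :=
  ∀ c ∈ C, ∀ c' ∈ C, ∀ z, hammingDist c z ≤ 1 → hammingDist c' z ≤ 1 → c = c'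

theorem sum_bits_flipBit {n : ℕ} {G : Type*} [AddCommGroup G] (hG : ∀ g : G, g + g = 0)
    (h : Fin n → G) (x : Fin n → Bool) (j : Fin n) :
    ∑ i, (if flipBit x j i then h i else 0) = ∑ i, (if x i then h i else 0) + h j := by
  rw [← Finset.add_sum_erase _ _ (Finset.mem_univ j),
    ← Finset.add_sum_erase Finset.univ (fun i => if x i then h i else 0) (Finset.mem_univ j)]
  have : ∑ i ∈ Finset.univ.erase j, (if flipBit x j i then h i else 0) =
      ∑ i ∈ Finset.univ.erase j, (if x i then h i else 0) :=
    Finset.sum_congr rfl fun i hi => by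
      simp [flipBit, Function.update_of_ne (Finset.ne_of_mem_erase hi)]
  rw [this]
  cases hx : x j
  · simp [flipBit, hx, add_comm]
  · simp only [flipBit, hx, Function.update_self, Bool.not_true, Bool.false_eq_true, if_false,
      if_true, zero_add]
    rw [add_right_comm, hG, zero_add]

/-- A code of `2 ^ (n - r)` words correcting one error exists if `n < 2 ^ r` and `r ≤ n`. -/
theorem exists_correctsOne {n r : ℕ} (hn : n < 2 ^ r) (hr : r ≤ n) :
    ∃ C : Finset (Fin n → Bool), CorrectsOne C ∧ 2 ^ (n - r) ≤ C.card := by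
  classical
  obtain ⟨f⟩ : Nonempty (Option (Fin n) ↪ (Fin r → ZMod 2)) := by
    apply Function.Embedding.nonempty_of_card_le
    simpa [ZMod.card] using hn
  have hG : ∀ g : Fin r → ZMod 2, g + g = 0 := fun g => funext fun i => CharTwo.add_self_eq_zero _
  -- The shift gives "no error" the syndrome 0; the error positions get distinct nonzero ones.
  -- Pigeonhole then finds a large syndrome class, which is the code.
  set h : Option (Fin n) → Fin r → ZMod 2 := fun o => f o - f none with hh
  have hinj : Function.Injective h := fun o o' e => f.injective (sub_left_injective e)
  let syn : (Fin n → Bool) → Fin r → ZMod 2 := fun x => ∑ i, if x i then h (some i) else 0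
  have hsyn : ∀ x o, syn (flipBit? x o) = syn x + h o := by
    intro x o
    cases o with
    | none => simp [flipBit?, hh]
    | some j => exact sum_bits_flipBit hG (fun i => h (some i)) x j
  obtain ⟨g, hg⟩ := Fintype.exists_le_card_fiber_of_mul_le_card (n := 2 ^ (n - r)) syn (by
    simp [ZMod.card, ← pow_add, Nat.add_sub_cancel' hr])
  refine ⟨Finset.univ.filter fun x => syn x = g, ?_, hg⟩
  intro c hc c' hc' z hz hz'
  obtain ⟨o, rfl⟩ := exists_eq_flipBit?_of_hammingDist_le_one hz
  obtain ⟨o', ho'⟩ := exists_eq_flipBit?_of_hammingDist_le_one hz'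
  have e := congrArg syn ho'
  rw [hsyn, hsyn, (Finset.mem_filter.mp hc).2, (Finset.mem_filter.mp hc').2] at e
  have := hinj (add_left_cancel e)
  subst this
  exact flipBit?_injective o ho'

/-! ### Encoding in the last one or two blocks. -/

/-- A set can be mapped injectively to any set with at least as many elements. -/
theorem exists_injOn_mem_of_card_le {α β : Type*} [Nonempty β] (A : Finset α) (T : Finset β)
    (h : A.card ≤ T.card) : ∃ f : α → β, Set.InjOn f A ∧ ∀ m ∈ A, f m ∈ T := by
  classical
  obtain ⟨F⟩ : Nonempty (A ↪ T) := by
    apply Function.Embedding.nonempty_of_card_le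
    simpa using h
  refine ⟨fun m => if hm : m ∈ A then F ⟨m, hm⟩ else Classical.arbitrary β, ?_, ?_⟩
  · intro m hm m' hm' e
    simp only [Finset.mem_coe] at hm hm'
    simp only [hm, hm', dif_pos] at e
    simpa using F.injective (Subtype.ext e)
  · intro m hm
    simp [hm]

/-- Elements can be distributed over boxes with prescribed capacities. -/
theorem exists_card_fiber_le {α β : Type*} [Nonempty β] [Fintype β] [DecidableEq β]
    (A : Finset α) (s : β → ℕ) (h : A.card ≤ ∑ y, s y) :
    ∃ f : α → β, ∀ y, (A.filter fun m => f m = y).card ≤ s y := by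
  classical
  obtain ⟨F, hF, hFT⟩ := exists_injOn_mem_of_card_le A
    (Finset.univ.sigma fun y : β => Finset.range (s y)) (by simpa using h)
  refine ⟨fun m => (F m).1, fun y => ?_⟩
  calc _ ≤ (Finset.range (s y)).card := by
        refine Finset.card_le_card_of_injOn (fun m => (F m).2) ?_ ?_
        · intro m hm
          obtain ⟨hmA, rfl⟩ := Finset.mem_filter.mp hm
          exact (Finset.mem_sigma.mp (hFT m hmA)).2
        · intro m hm m' hm' e
          obtain ⟨hm, hy⟩ := Finset.mem_filter.mp hm
          obtain ⟨hm', hy'⟩ := Finset.mem_filter.mp hm'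
          exact hF hm hm' (Sigma.ext (hy.trans hy'.symm) (heq_of_eq e))
    _ = s y := Finset.card_range _

/-- The last block: `e m` counts the errors made before, if `m` is the message.  The messages
without error so far are sent by words of `C`, those with one error by words outside the balls
around them. -/
theorem exists_lastBlock {α : Type*} [Fintype α] {n : ℕ} {C : Finset (Fin n → Bool)}
    (hC : CorrectsOne C) (e : α → ℕ) (hcard : (Finset.univ.filter fun m => e m = 0).card ≤ C.card)
    (hvol : (Finset.univ.filter fun m => e m = 0).card * (n + 1) +
      (Finset.univ.filter fun m => e m = 1).card ≤ 2 ^ n) :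
    ∃ g : α → Fin n → Bool, ∀ m m' z, m ≠ m' → e m + hammingDist (g m) z ≤ 1 →
      ¬ e m' + hammingDist (g m') z ≤ 1 := by
  classical
  obtain ⟨f, hf, hfC⟩ := exists_injOn_mem_of_card_le _ C hcard
  set A := Finset.univ.filter fun m => e m = 0 with hA
  set B := Finset.univ.filter fun m => e m = 1 with hB
  set W := A.biUnion fun m => Finset.univ.filter fun z => hammingDist (f m) z ≤ 1 with hW
  have hWcard : W.card ≤ A.card * (n + 1) :=
    Finset.card_biUnion_le_card_mul _ _ _ fun m _ => card_hammingBall_one_le (f m)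
  obtain ⟨f', hf', hfW⟩ := exists_injOn_mem_of_card_le B Wᶜ (by
    rw [Finset.card_compl]
    simp only [Fintype.card_pi, Fintype.card_bool, Finset.prod_const, Finset.card_univ,
      Fintype.card_fin]
    omega)
  have hmix : ∀ m m' z, e m = 0 → e m' = 1 → hammingDist (f m) z ≤ 1 →
      hammingDist (f' m') z = 0 → False := by
    intro m m' z h0 h1 hz hz'
    refine Finset.mem_compl.mp (hfW m' (by simp [hB, h1])) ?_
    rw [hammingDist_eq_zero.mp hz']
    exact Finset.mem_biUnion.mpr ⟨m, by simp [hA, h0], by simp [hz]⟩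
  -- Messages with `e m ≥ 2` get an irrelevant word, since they are already excluded.
  refine ⟨fun m => if e m = 0 then f m else f' m, fun m m' z hne h h' => ?_⟩
  by_cases h0 : e m = 0 <;> by_cases h0' : e m' = 0
  · simp only [h0, h0', if_true, zero_add] at h h'
    have hm : m ∈ A := by simp [hA, h0]
    have hm' : m' ∈ A := by simp [hA, h0']
    exact hne (hf hm hm' (hC _ (hfC m hm) _ (hfC m' hm') z h h'))
  · simp only [h0, h0', if_true, if_false, zero_add] at h h'
    exact hmix m m' z h0 (by omega) h (by omega)
  · simp only [h0, h0', if_true, if_false, zero_add] at h h'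
    exact hmix m' m z h0' (by omega) h' (by omega)
  · simp only [h0, h0', if_false] at h h'
    have hm : m ∈ B := by simp only [hB, Finset.mem_filter, Finset.mem_univ, true_and]; omega
    have hm' : m' ∈ B := by simp only [hB, Finset.mem_filter, Finset.mem_univ, true_and]; omega
    refine hne (hf' hm hm' ?_)
    rw [hammingDist_eq_zero.mp (by omega : hammingDist (f' m) z = 0),
      hammingDist_eq_zero.mp (by omega : hammingDist (f' m') z = 0)]

/-- The last two blocks, with one feedback between them: at most `s y` of the messages without
error so far are sent by the word `y` in the first of them. -/
theorem exists_lastTwoBlocks {α : Type*} [Fintype α] {p q : ℕ} {C : Finset (Fin q → Bool)}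
    (hC : CorrectsOne C) (e : α → ℕ) (s : (Fin p → Bool) → ℕ)
    (hs : (Finset.univ.filter fun m => e m = 0).card ≤ ∑ y, s y) (hsC : ∀ y, s y ≤ C.card)
    (hsvol : ∀ y, s y * (q + 1) + ∑ j, s (flipBit y j) ≤ 2 ^ q)
    (hvol : (Finset.univ.filter fun m => e m = 0).card * (p + q + 1) +
      (Finset.univ.filter fun m => e m = 1).card ≤ 2 ^ (p + q)) :
    ∃ (c : α → Fin p → Bool) (g : α → (Fin p → Bool) → Fin q → Bool),
      ∀ m m' y z, m ≠ m' → e m + hammingDist (c m) y + hammingDist (g m y) z ≤ 1 →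
        ¬ e m' + hammingDist (c m') y + hammingDist (g m' y) z ≤ 1 := by
  classical
  set A := Finset.univ.filter fun m => e m = 0 with hA
  set B := Finset.univ.filter fun m => e m = 1 with hB
  obtain ⟨f, hf⟩ := exists_card_fiber_le A s hs
  set a : (Fin p → Bool) → ℕ := fun y => (A.filter fun m => f m = y).card with ha
  -- The number of last blocks that the messages of `A` need once `y` is received: a ball if `y` was
  -- sent, one word if a neighbour of `y` was sent. What is left, `2 ^ q - u y`, is the room for
  -- messages of `B`.
  set u : (Fin p → Bool) → ℕ := fun y => a y * (q + 1) + ∑ j, a (flipBit y j) with hu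
  have hu_le : ∀ y, u y ≤ 2 ^ q := fun y =>
    (Nat.add_le_add (Nat.mul_le_mul_right _ (hf y))
      (Finset.sum_le_sum fun j _ => hf (flipBit y j))).trans (hsvol y)
  have hsum_a : ∑ y, a y = A.card :=
    (Finset.card_eq_sum_card_fiberwise fun m _ => Finset.mem_coe.mpr (Finset.mem_univ (f m))).symm
  have hsum_u : ∑ y, u y = A.card * (p + q + 1) := by
    rw [hu, Finset.sum_add_distrib, ← Finset.sum_mul, hsum_a, Finset.sum_comm]
    have : ∀ j : Fin p, ∑ y, a (flipBit y j) = A.card := fun j => by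
      rw [← hsum_a]
      exact (flipBit_involutive j).bijective.sum_comp a
    simp only [this, Finset.sum_const, Finset.card_univ, Fintype.card_fin, smul_eq_mul]
    ring
  obtain ⟨f', hf'⟩ := exists_card_fiber_le B (fun y => 2 ^ q - u y) (by
    have h1 : ∑ y, (2 ^ q - u y) + ∑ y, u y = 2 ^ (p + q) := by
      rw [← Finset.sum_add_distrib, Finset.sum_congr rfl fun y _ => Nat.sub_add_cancel (hu_le y)]
      simp [pow_add]
    omega)
  set c : α → Fin p → Bool := fun m => if e m = 0 then f m else f' m with hc
  have key : ∀ y, ∃ g : α → Fin q → Bool, ∀ m m' z, m ≠ m' →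
      e m + hammingDist (c m) y + hammingDist (g m) z ≤ 1 →
        ¬ e m' + hammingDist (c m') y + hammingDist (g m') z ≤ 1 := by
    intro y
    have h0 : (Finset.univ.filter fun m => e m + hammingDist (c m) y = 0) =
        A.filter fun m => f m = y := by
      ext m
      simp only [hA, hc, Finset.mem_filter, Finset.mem_univ, true_and, Nat.add_eq_zero_iff,
        hammingDist_eq_zero]
      exact and_congr_right fun h => by simp [h]
    have h1 : (Finset.univ.filter fun m => e m + hammingDist (c m) y = 1) ⊆
        (Finset.univ.biUnion fun j => A.filter fun m => f m = flipBit y j) ∪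
          B.filter fun m => f' m = y := by
      intro m hm
      have hm := (Finset.mem_filter.mp hm).2
      simp only [hA, hB, Finset.mem_union, Finset.mem_biUnion, Finset.mem_filter, Finset.mem_univ,
        true_and]
      by_cases h : e m = 0
      · simp only [hc, h, if_true, zero_add] at hm
        rw [hammingDist_comm] at hm
        obtain ⟨j, hj⟩ := exists_eq_flipBit_of_hammingDist_eq_one hm
        exact Or.inl ⟨j, h, hj⟩
      · simp only [hc, h, if_false] at hm
        exact Or.inr ⟨by omega, hammingDist_eq_zero.mp (by omega)⟩
    have h1card : (Finset.univ.filter fun m => e m + hammingDist (c m) y = 1).card ≤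
        ∑ j, a (flipBit y j) + (2 ^ q - u y) :=
      (Finset.card_le_card h1).trans <| (Finset.card_union_le _ _).trans <|
        Nat.add_le_add Finset.card_biUnion_le (hf' y)
    refine exists_lastBlock hC (fun m => e m + hammingDist (c m) y) ?_ ?_
    · rw [h0]
      exact (hf y).trans (hsC y)
    · rw [h0]
      have := hu_le y
      have h2 : u y = a y * (q + 1) + ∑ j, a (flipBit y j) := rfl
      change a y * (q + 1) + _ ≤ _
      omega
  choose g hg using key
  exact ⟨c, fun m y => g y m, fun m m' y z => hg y m m' z⟩

/-! ### Causality bit by bit, and assembling strategies from blocks. -/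

namespace FeedbackStrategy

theorem enc_congr {k n M : ℕ} (S : FeedbackStrategy k n M) (m : Fin M) {y y' : Fin n → Bool}
    (j : Fin n) (h : ∀ l < j, y l = y' l) : S.enc m y j = S.enc m y' j := by
  classical
  -- The block containing `j` is the last one that starts at or before `j`.
  obtain ⟨i, hi, hmax⟩ := Finset.exists_max_image
    (Finset.univ.filter fun i : Fin (k + 1) => ∑ a with a < i, S.len a ≤ (j : ℕ)) id
    ⟨0, by simp⟩
  have hi := (Finset.mem_filter.mp hi).2
  refine S.causal m i y y' (fun l hl => h l (Fin.lt_def.mpr (hl.trans_le hi))) j hi ?_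
  by_contra! hle
  rcases Fin.eq_castSucc_or_eq_last i with ⟨i', rfl⟩ | rfl
  · have hfilter : (Finset.univ.filter fun a => a < i'.succ) =
        Finset.univ.filter fun a => a ≤ i'.castSucc := by
      ext a
      simp [Fin.lt_def, Fin.le_def]
    have := hmax i'.succ (by simp [hfilter, hle])
    simp [Fin.le_def] at this
  · have : ∑ a with a ≤ Fin.last k, S.len a = n := by
      simpa [Fin.le_last] using S.sum_len
    have := j.2
    omega

end FeedbackStrategy

/-- Complete feedback is at least as good as any other strategy. -/
theorem CanTransmit.complete {k n t M : ℕ} (hn : 1 ≤ n) (h : CanTransmit k n t M) :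
    CanTransmit (n - 1) n t M := by
  obtain ⟨S, hS⟩ := h
  refine ⟨{ len := fun _ => 1
            len_pos := fun _ => one_pos
            sum_len := by simp [Nat.sub_add_cancel hn]
            enc := S.enc
            causal := ?_ }, hS⟩
  intro m i y y' h j h1 h2
  refine S.enc_congr m j fun l hl => h l ?_
  have : ∑ a with a < i, 1 = (i : ℕ) := by simp [Finset.filter_gt_eq_Iio]
  have : ∑ a with a ≤ i, 1 = (i : ℕ) + 1 := by simp [Finset.filter_ge_eq_Iic]
  have := Fin.lt_def.mp hl
  omega

theorem canTransmit_of_le_one {n t M : ℕ} (hn : 1 ≤ n) (hM : M ≤ 1) : CanTransmit 0 n t M := by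
  refine ⟨{ len := fun _ => n
            len_pos := fun _ => hn
            sum_len := by simp
            enc := fun _ _ _ => false
            causal := fun _ _ _ _ _ _ _ _ => rfl }, fun m m' hne => ?_⟩
  have := m.2
  have := m'.2
  exact absurd (Fin.ext (by omega)) hne

theorem hammingDist_append {p q : ℕ} (x x' : Fin p → Bool) (z z' : Fin q → Bool) :
    hammingDist (Fin.append x z) (Fin.append x' z') = hammingDist x x' + hammingDist z z' := by
  simp [hammingDist, Finset.card_filter, Fin.sum_univ_add]

/-- Three encoding functions, for blocks of lengths `p`, `q`, `r`, give a strategy with two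
feedbacks. -/
theorem canTransmit_two_of_blocks {p q r t M : ℕ} (hp : 0 < p) (hq : 0 < q) (hr : 0 < r)
    (c : Fin M → Fin p → Bool) (d : Fin M → (Fin p → Bool) → Fin q → Bool)
    (g : Fin M → (Fin p → Bool) → (Fin q → Bool) → Fin r → Bool)
    (h : ∀ m m' x y z, m ≠ m' →
      hammingDist (c m) x + hammingDist (d m x) y + hammingDist (g m x y) z ≤ t →
        ¬ hammingDist (c m') x + hammingDist (d m' x) y + hammingDist (g m' x y) z ≤ t) :
    CanTransmit 2 (p + q + r) t M := by
  let X : (Fin (p + q + r) → Bool) → Fin p → Bool :=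
    fun w j => w (Fin.castAdd r (Fin.castAdd q j))
  let Y : (Fin (p + q + r) → Bool) → Fin q → Bool :=
    fun w j => w (Fin.castAdd r (Fin.natAdd p j))
  let Z : (Fin (p + q + r) → Bool) → Fin r → Bool := fun w j => w (Fin.natAdd (p + q) j)
  have hsplit : ∀ w, w = Fin.append (Fin.append (X w) (Y w)) (Z w) := by
    intro w
    funext j
    refine Fin.addCases (fun j => ?_) (fun j => by simp [Z]) j
    refine Fin.addCases (fun j => by simp [X]) (fun j => by simp [Y]) j
  refine ⟨{ len := ![p, q, r]
            len_pos := by intro i; fin_cases i <;> assumption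
            sum_len := by simp [Fin.sum_univ_three]
            enc := fun m w =>
              Fin.append (Fin.append (c m) (d m (X w))) (g m (X w) (Y w))
            causal := ?_ }, fun m m' hne => Set.disjoint_left.mpr fun w hw hw' => ?_⟩
  · intro m i w w' hww j
    have hX : p ≤ ∑ a with a < i, ![p, q, r] a → X w = X w' := fun hle =>
      funext fun l => hww _ (lt_of_lt_of_le (by simp) hle)
    have hY : p + q ≤ ∑ a with a < i, ![p, q, r] a → Y w = Y w' := fun hle =>
      funext fun l => hww _ (lt_of_lt_of_le (by simp) hle)
    clear hww hsplit
    refine Fin.addCases (fun j => ?_) (fun j => ?_) j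
    · refine Fin.addCases (fun j => ?_) (fun j => ?_) j
      · simp
      · intro _ h2
        have hX := hX (by
          fin_cases i <;> simp [Finset.sum_filter, Fin.sum_univ_three] at h2 ⊢)
        simp [hX]
    · intro _ h2
      fin_cases i <;> simp [Finset.sum_filter, Fin.sum_univ_three] at h2 hX hY ⊢
      · omega
      · rw [hX, hY]
  · have hdist : ∀ m, hammingDist
        (Fin.append (Fin.append (c m) (d m (X w))) (g m (X w) (Y w))) w =
          hammingDist (c m) (X w) + hammingDist (d m (X w)) (Y w) +
            hammingDist (g m (X w) (Y w)) (Z w) := by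
      intro m
      conv_lhs => rw [hsplit w]
      rw [hammingDist_append, hammingDist_append]
      simp only [← hsplit w]
    exact h m m' (X w) (Y w) (Z w) hne ((hdist m).symm.trans_le hw) ((hdist m').symm.trans_le hw')

/-! ### The upper bound. -/

namespace FeedbackStrategy

/-- The error pattern when `y` is received and the message is `m`. -/
def errorPattern {k n M : ℕ} (S : FeedbackStrategy k n M) (m : Fin M) (y : Fin n → Bool) :
    Fin n → Bool := fun j => xor (S.enc m y j) (y j)

/-- The received word is recovered from the error pattern bit by bit, because each transmitted bit
depends only on earlier received bits. So clouds can be counted through error patterns. -/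
theorem errorPattern_bijective {k n M : ℕ} (S : FeedbackStrategy k n M) (m : Fin M) :
    Function.Bijective (S.errorPattern m) := by
  refine Finite.injective_iff_bijective.mp fun y y' h => ?_
  have key : ∀ (l : ℕ) (j : Fin n), (j : ℕ) = l → y j = y' j := by
    intro l
    induction l using Nat.strong_induction_on with
    | _ l ih =>
      rintro j rfl
      have h1 := S.enc_congr m j fun i hi => ih i hi i rfl
      have h2 : xor (S.enc m y j) (y j) = xor (S.enc m y' j) (y' j) := congrFun h j
      rw [h1] at h2
      exact Bool.xor_right_inj.mp h2
  exact funext fun j => key j j rfl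

theorem hammingDist_enc {k n M : ℕ} (S : FeedbackStrategy k n M) (m : Fin M) (y : Fin n → Bool) :
    hammingDist (S.enc m y) y = hammingDist (S.errorPattern m y) fun _ => false := by
  simp [hammingDist, errorPattern]

open Classical in
/-- The part of the cloud of `m` that consists of words with first bit `b`. -/
noncomputable def halfCloud {k n M : ℕ} (S : FeedbackStrategy k (n + 1) M) (b : Bool)
    (m : Fin M) : Finset (Fin (n + 1) → Bool) :=
  Finset.univ.filter fun y => y 0 = b ∧ y ∈ S.cloud 1 m

theorem card_halfCloud {k n M : ℕ} (S : FeedbackStrategy k (n + 1) M) (b : Bool) (m : Fin M) :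
    (if S.enc m (fun _ => false) 0 = b then n + 1 else 1) ≤ (S.halfCloud b m).card := by
  classical
  have h0 : ∀ y, S.enc m y 0 = S.enc m (fun _ => false) 0 := fun y =>
    S.enc_congr m 0 fun l hl => absurd hl (Fin.not_lt_zero l)
  obtain ⟨inv, hinv⟩ := (S.errorPattern_bijective m).surjective.hasRightInverse
  have hmem : ∀ x, hammingDist x (fun _ => false) ≤ 1 →
      xor (S.enc m (fun _ => false) 0) (x 0) = b → inv x ∈ S.halfCloud b m := by
    intro x hx hb
    have hx0 := congrFun (hinv x) 0
    simp only [errorPattern, h0] at hx0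
    refine Finset.mem_filter.mpr ⟨Finset.mem_univ _, ?_, ?_⟩
    · rw [← hb, ← hx0]
      cases S.enc m (fun _ => false) 0 <;> simp
    · change hammingDist _ _ ≤ 1
      rwa [hammingDist_enc, hinv]
  split_ifs with hb
  -- The patterns that leave bit 0 intact: `x 0` has no error, and `x j` for `j ≠ 0` has one at `j`.
  · let x : Fin (n + 1) → Fin (n + 1) → Bool := fun j i => decide (i = j ∧ i ≠ 0)
    have hx : ∀ j, hammingDist (x j) (fun _ => false) ≤ 1 := fun j =>
      Finset.card_le_one.mpr fun i hi i' hi' => by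
        simp only [x, Finset.mem_filter, Finset.mem_univ, true_and, ne_eq,
          decide_eq_false_iff_not, not_not] at hi hi'
        rw [hi.1, hi'.1]
    have hxinj : Function.Injective x := fun j j' h => by
      have h1 := congrFun h j
      have h2 := congrFun h j'
      simp only [x, decide_eq_decide, true_and] at h1 h2
      by_cases hj : j = 0
      · by_cases hj' : j' = 0
        · rw [hj, hj']
        · exact (h2.mpr hj').1.symm
      · exact (h1.mp hj).1
    calc n + 1 = (Finset.univ.image fun j => inv (x j)).card := by
          rw [Finset.card_image_of_injective _ (f := fun j => inv (x j)) (hinv.injective.comp hxinj)]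
          simp
      _ ≤ _ := Finset.card_le_card (Finset.image_subset_iff.mpr fun j _ =>
          hmem _ (hx j) (by simp [x, hb]))
  · refine Finset.card_pos.mpr ⟨inv fun i => decide (i = 0), hmem _ ?_ ?_⟩
    · exact Finset.card_le_one.mpr fun i hi i' hi' => by
        simp only [Finset.mem_filter, Finset.mem_univ, true_and, ne_eq,
          decide_eq_false_iff_not, not_not] at hi hi'
        rw [hi, hi']
    · revert hb
      cases S.enc m (fun _ => false) 0 <;> cases b <;> simp

theorem sum_card_halfCloud_le {k n M : ℕ} (S : FeedbackStrategy k (n + 1) M) (hS : S.Corrects 1)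
    (b : Bool) : ∑ m, (S.halfCloud b m).card ≤ 2 ^ n := by
  classical
  rw [← Finset.card_biUnion fun m _ m' _ hne => Finset.disjoint_left.mpr fun y hy hy' =>
    Set.disjoint_left.mp (hS m m' hne) (Finset.mem_filter.mp hy).2.2
      (Finset.mem_filter.mp hy').2.2]
  calc _ ≤ (Finset.univ : Finset (Fin n → Bool)).card := by
        refine Finset.card_le_card_of_injOn Fin.tail (fun _ _ => Finset.mem_coe.mpr
          (Finset.mem_univ _)) fun y hy y' hy' h => ?_
        simp only [Finset.coe_biUnion, Set.mem_iUnion, halfCloud, Finset.coe_filter,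
          Set.mem_ofPred_eq] at hy hy'
        obtain ⟨_, _, _, hy, _⟩ := hy
        obtain ⟨_, _, _, hy', _⟩ := hy'
        rw [← Fin.cons_self_tail y, ← Fin.cons_self_tail y', h, hy, hy']
    _ = 2 ^ n := by simp

/-- The volume bound in a half of the cube. -/
theorem half_volume_bound {k n M : ℕ} (S : FeedbackStrategy k (n + 1) M) (hS : S.Corrects 1)
    (b : Bool) :
    M + (Finset.univ.filter fun m => S.enc m (fun _ => false) 0 = b).card * n ≤ 2 ^ n := by
  calc _ = ∑ m, (if S.enc m (fun _ => false) 0 = b then n + 1 else 1) := by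
        rw [Finset.sum_congr rfl fun m _ => show (if S.enc m (fun _ => false) 0 = b then n + 1 else 1)
          = 1 + if S.enc m (fun _ => false) 0 = b then n else 0 by split_ifs <;> omega,
          Finset.sum_add_distrib, ← Finset.sum_filter]
        simp
    _ ≤ _ := (Finset.sum_le_sum fun m _ => S.card_halfCloud b m).trans
        (S.sum_card_halfCloud_le hS b)

end FeedbackStrategy

/-- The word length is `n + 1`. The sum of the two bounds is `M * (n + 2) ≤ 2 ^ (n + 1)`, so `M ≤ 2
* Q + 1`. If `M = 2 * Q + 1`, one of `a`, `b` is at least `Q + 1`, and its bound says that the rest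
is at least `2 * (n + 1)`. -/
theorem le_Mad_of_half_volume {n M a b : ℕ} (hM : a + b = M) (ha : M + a * n ≤ 2 ^ n)
    (hb : M + b * n ≤ 2 ^ n) : M ≤ Mad (n + 1) := by
  have hlt : 2 ^ (n + 1) < 2 * (n + 2) * (2 ^ (n + 1) / (2 * (n + 2)) + 1) :=
    Nat.lt_mul_div_succ _ (by omega)
  have hle := succ_mul_evenHamming_le (n + 1)
  unfold Mad hammingRest evenHamming at *
  rw [show n + 1 + 1 = n + 2 from rfl] at *
  set Q := 2 ^ (n + 1) / (2 * (n + 2))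
  have hpow : 2 ^ (n + 1) = 2 * 2 ^ n := by ring
  rw [hpow] at *
  have hMQ : M < 2 * Q + 2 := by
    by_contra! h
    have h1 : (2 * Q + 2) * (n + 2) ≤ M * (n + 2) := Nat.mul_le_mul_right _ h
    have h2 : M * (n + 2) = (M + a * n) + (M + b * n) := by rw [← hM]; ring
    have h3 : 2 * (n + 2) * (Q + 1) = (2 * Q + 2) * (n + 2) := by ring
    omega
  split_ifs with hr
  · by_contra! h
    obtain rfl : M = 2 * Q + 1 := by omega
    have hcase : ∀ x, Q + 1 ≤ x → 2 * Q + 1 + x * n ≤ 2 ^ n → False := by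
      intro x hx h
      have h1 : (Q + 1) * n ≤ x * n := Nat.mul_le_mul_right _ hx
      have h2 : (n + 2) * (2 * Q) = 2 * (Q * n) + 4 * Q := by ring
      have h3 : (Q + 1) * n = Q * n + n := by ring
      omega
    rcases Nat.lt_or_ge Q a with h' | h'
    · exact hcase a h' ha
    · exact hcase b (by omega) hb
  · omega

theorem CanTransmit.le_Mad {k n M : ℕ} (hn : 1 ≤ n) (h : CanTransmit k n 1 M) : M ≤ Mad n := by
  obtain ⟨n, rfl⟩ := Nat.exists_eq_add_of_le' hn
  obtain ⟨S, hS⟩ := h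
  refine le_Mad_of_half_volume ?_ (S.half_volume_bound hS true) (S.half_volume_bound hS false)
  have := Finset.card_filter_add_card_filter_not (s := (Finset.univ : Finset (Fin M)))
    (fun m => S.enc m (fun _ => false) 0 = true)
  simpa using this

/-! ### The scheme with two feedbacks. -/

/-- Conversely, an even split meets the volume bound in the fuller half; for odd `Mad (n + 1)` this
is exactly where the threshold on the rest is needed. -/
theorem Mad_half_volume (n : ℕ) :
    (Mad (n + 1) + 1) / 2 * (n + 1) + Mad (n + 1) / 2 ≤ 2 ^ n := by
  have hle := succ_mul_evenHamming_le (n + 1)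
  unfold Mad hammingRest evenHamming at *
  set Q := 2 ^ (n + 1) / (2 * (n + 1 + 1))
  have hpow : 2 ^ (n + 1) = 2 * 2 ^ n := by ring
  rw [hpow] at *
  have h1 : (n + 1 + 1) * (2 * Q) = 2 * (Q * n) + 4 * Q := by ring
  split_ifs with hr
  · rw [show (2 * Q + 1) / 2 = Q by omega, show 2 * Q / 2 = Q by omega]
    have : Q * (n + 1) = Q * n + Q := by ring
    omega
  · rw [show (2 * Q + 1 + 1) / 2 = Q + 1 by omega, show (2 * Q + 1) / 2 = Q by omega]
    have : (Q + 1) * (n + 1) = Q * n + Q + n + 1 := by ring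
    omega

/-- The scheme with two feedbacks: a block of length one, a block of length `p` and a block of
length `q`, which is encoded by a code of length `q` with redundancy `r`. -/
theorem canTransmit_two_Mad {p q r : ℕ} (hp : 0 < p) (hr : 0 < r) (hrq : r ≤ q) (hqr : q < 2 ^ r)
    (s : (Fin p → Bool) → ℕ) (hs : (Mad (1 + p + q) + 1) / 2 ≤ ∑ y, s y)
    (hsC : ∀ y, s y ≤ 2 ^ (q - r))
    (hsvol : ∀ y, s y * (q + 1) + ∑ j, s (flipBit y j) ≤ 2 ^ q) :
    CanTransmit 2 (1 + p + q) 1 (Mad (1 + p + q)) := by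
  classical
  obtain ⟨C, hC, hCcard⟩ := exists_correctsOne hqr hrq
  have hvol := Mad_half_volume (p + q)
  rw [show p + q + 1 = 1 + p + q by ring] at hvol
  set M := Mad (1 + p + q)
  let c : Fin M → Fin 1 → Bool := fun m _ => decide ((m : ℕ) < (M + 1) / 2)
  have hcard : ∀ x, (Finset.univ.filter fun m => hammingDist (c m) x = 0).card ≤ (M + 1) / 2 ∧
      (Finset.univ.filter fun m => hammingDist (c m) x = 0).card +
        (Finset.univ.filter fun m => hammingDist (c m) x = 1).card ≤ M := by
    intro x
    constructor
    · have hlt : (Finset.univ.filter fun m : Fin M => (m : ℕ) < (M + 1) / 2).card = (M + 1) / 2 := by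
        rw [Fin.card_filter_val_lt]
        omega
      have hadd := Finset.card_filter_add_card_filter_not (s := (Finset.univ : Finset (Fin M)))
        (fun m => (m : ℕ) < (M + 1) / 2)
      rw [hlt, Finset.card_univ, Fintype.card_fin] at hadd
      have hiff : ∀ m, hammingDist (c m) x = 0 ↔ decide ((m : ℕ) < (M + 1) / 2) = x 0 := fun m => by
        simp [c, funext_iff]
      simp only [hiff]
      cases x 0
      · simp only [decide_eq_false_iff_not]
        omega
      · simp only [decide_eq_true_eq]
        omega
    · rw [← Finset.card_union_of_disjoint (Finset.disjoint_filter.mpr fun _ _ h h' => by omega)]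
      exact (Finset.card_le_univ _).trans_eq (Fintype.card_fin M)
  have hblocks : ∀ x, ∃ (d : Fin M → (Fin p → Bool)) (g : Fin M → (Fin p → Bool) → Fin q → Bool),
      ∀ m m' y z, m ≠ m' →
        hammingDist (c m) x + hammingDist (d m) y + hammingDist (g m y) z ≤ 1 →
          ¬ hammingDist (c m') x + hammingDist (d m') y + hammingDist (g m' y) z ≤ 1 := by
    intro x
    obtain ⟨h1, h2⟩ := hcard x
    refine exists_lastTwoBlocks hC (fun m => hammingDist (c m) x) s (h1.trans hs)
      (fun y => (hsC y).trans hCcard) hsvol ?_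
    refine le_trans ?_ hvol
    -- With `a` messages without error and `b` with one, the volume is `a * (p + q) + (a + b)`,
    -- where `a ≤ (M + 1) / 2` and `a + b ≤ M`.
    rw [show 1 + p + q = p + q + 1 by ring, mul_add_one, mul_add_one]
    have := Nat.mul_le_mul_right (p + q) h1
    omega
  choose d g hdg using hblocks
  exact canTransmit_two_of_blocks one_pos hp (by omega) c (fun m x => d x m) (fun m x => g x m)
    fun m m' x y z => hdg x m m' y z

theorem canTransmit_two_Mad_of_const {p q r s : ℕ} (hp : 0 < p) (hr : 0 < r) (hrq : r ≤ q)
    (hqr : q < 2 ^ r) (hs : (Mad (1 + p + q) + 1) / 2 ≤ 2 ^ p * s) (hsC : s ≤ 2 ^ (q - r))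
    (hsvol : s * (1 + p + q) ≤ 2 ^ q) : CanTransmit 2 (1 + p + q) 1 (Mad (1 + p + q)) := by
  refine canTransmit_two_Mad hp hr hrq hqr (fun _ => s) (by simpa using hs) (fun _ => hsC)
    fun _ => ?_
  refine le_of_eq_of_le ?_ hsvol
  simp only [Finset.sum_const, Finset.card_univ, Fintype.card_fin, smul_eq_mul]
  ring

/-! ### Choice of the parameters. -/

theorem two_mul_add_four_le_two_pow {L : ℕ} (hL : 4 ≤ L) : 2 * L + 4 ≤ 2 ^ L := by
  induction L, hL using Nat.le_induction with
  | base => norm_num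
  | succ L _ ih => rw [pow_succ]; omega

/-- The average load of a word `y` is about `2 ^ q / (n + 1)`, and the constant load `t + 1` rounds
it up. The rounding costs `n` in volume, while replacing `n + 1` by `n` gains `t`; hence `n ≤ t`
suffices, and `q = 2 * L + 2` ensures it, as `n * (n + 1) ≤ 2 ^ q`. -/
theorem canTransmit_two_Mad_of_large {n : ℕ} (hn : 16 ≤ n) : CanTransmit 2 n 1 (Mad n) := by
  obtain ⟨L, hL, hLn, hnL⟩ : ∃ L, 4 ≤ L ∧ 2 ^ L ≤ n ∧ n < 2 ^ (L + 1) :=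
    ⟨Nat.log 2 n, Nat.le_log_of_pow_le one_lt_two hn, Nat.pow_log_le_self 2 (by omega),
      Nat.lt_pow_succ_log_self one_lt_two n⟩
  have hL2 := two_mul_add_four_le_two_pow hL
  obtain ⟨p, hp, rfl⟩ : ∃ p, 0 < p ∧ n = 1 + p + (2 * L + 2) :=
    ⟨n - (2 * L + 3), by omega, by omega⟩
  have hvol := Mad_half_volume (p + (2 * L + 2))
  rw [show p + (2 * L + 2) + 1 = 1 + p + (2 * L + 2) by ring] at hvol
  set q := 2 * L + 2
  set n := 1 + p + q
  have hdiv := Nat.lt_mul_div_succ (2 ^ q) (show 0 < n + 1 by omega)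
  have hdiv' := Nat.mul_div_le (2 ^ q) (n + 1)
  set t := 2 ^ q / (n + 1)
  have hpow : 2 ^ q = 2 ^ (L + 1) * 2 ^ (L + 1) := by rw [← pow_add]; congr 1; omega
  have hpow' : 2 ^ q = 2 ^ L * 2 ^ (L + 2) := by rw [← pow_add]; congr 1; omega
  refine canTransmit_two_Mad_of_const (r := L) (s := t + 1) hp (by omega) (by omega) (by omega)
    ?_ ?_ ?_
  · change (Mad n + 1) / 2 ≤ _
    by_contra! h
    have h1 : (2 ^ p * (t + 1) + 1) * (n + 1) ≤ 2 ^ (p + q) + 1 := by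
      refine (Nat.mul_le_mul_right (n + 1) (Nat.succ_le_of_lt h)).trans ?_
      rw [mul_add_one]
      omega
    have h2 : 2 ^ p * 2 ^ q ≤ 2 ^ p * ((n + 1) * (t + 1)) := Nat.mul_le_mul_left _ hdiv.le
    rw [pow_add, show (2 ^ p * (t + 1) + 1) * (n + 1) = 2 ^ p * ((n + 1) * (t + 1)) + n + 1 by
      ring] at h1
    omega
  · rw [show q - L = L + 2 by omega]
    by_contra! h
    have h1 : (2 ^ L + 1) * 2 ^ (L + 2) ≤ (n + 1) * t := Nat.mul_le_mul (by omega) (by omega)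
    have h2 : (2 ^ L + 1) * 2 ^ (L + 2) = 2 ^ q + 2 ^ (L + 2) := by rw [hpow']; ring
    have := Nat.two_pow_pos (L + 2)
    omega
  · have hnt : n ≤ t := by
      refine (Nat.le_div_iff_mul_le (by omega)).mpr ?_
      rw [hpow]
      exact Nat.mul_le_mul hnL.le hnL
    calc (t + 1) * n = (n + 1) * t + n - t := by
          rw [eq_tsub_iff_add_eq_of_le (by nlinarith)]; ring
      _ ≤ 2 ^ q := by omega

theorem canTransmit_two_Mad_three : CanTransmit 2 3 1 (Mad 3) :=
  canTransmit_two_Mad (p := 1) (q := 1) (r := 1) one_pos one_pos le_rfl (by norm_num)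
    -- The constant load 1 would need volume 3 > 2.
    (fun y => if y 0 then 1 else 0) (by decide) (by decide) (by decide)

theorem canTransmit_two_Mad_thirteen : CanTransmit 2 13 1 (Mad 13) :=
  canTransmit_two_Mad (p := 5) (q := 7) (r := 3) (by norm_num) (by norm_num) (by norm_num)
    -- A constant load would have to be at least 10, as 32 words serve 292 messages, and at most 9,
    -- as `13 * s ≤ 128`. Alternating by parity works: every neighbour of a word with load 10 has
    -- load 9.
    (by norm_num) (fun y => if xor (y 0) (xor (y 1) (xor (y 2) (xor (y 3) (y 4)))) then 10 else 9)
    (by decide +kernel) (by decide +kernel) (by decide +kernel)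

theorem canTransmit_two_Mad_of_three_le {n : ℕ} (hn : 3 ≤ n) : CanTransmit 2 n 1 (Mad n) := by
  rcases Nat.lt_or_ge n 16 with h | h
  · have aux : ∀ p q r s : ℕ, 0 < p ∧ 0 < r ∧ r ≤ q ∧ q < 2 ^ r ∧
        (Mad (1 + p + q) + 1) / 2 ≤ 2 ^ p * s ∧ s ≤ 2 ^ (q - r) ∧ s * (1 + p + q) ≤ 2 ^ q →
        CanTransmit 2 (1 + p + q) 1 (Mad (1 + p + q)) := fun p q r s h =>
      canTransmit_two_Mad_of_const h.1 h.2.1 h.2.2.1 h.2.2.2.1 h.2.2.2.2.1 h.2.2.2.2.2.1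
        h.2.2.2.2.2.2
    interval_cases n
    · exact canTransmit_two_Mad_three
    · exact aux 1 2 2 1 (by decide +kernel)
    · exact aux 1 3 2 1 (by decide +kernel)
    · exact aux 2 3 2 1 (by decide +kernel)
    · exact aux 3 3 2 1 (by decide +kernel)
    · exact aux 1 6 3 8 (by decide +kernel)
    · exact aux 1 7 3 13 (by decide +kernel)
    · exact aux 2 7 3 12 (by decide +kernel)
    · exact aux 3 7 3 11 (by decide +kernel)
    · exact aux 4 7 3 10 (by decide +kernel)
    · exact canTransmit_two_Mad_thirteen
    · exact aux 6 7 3 9 (by decide +kernel)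
    · exact aux 7 7 3 8 (by decide +kernel)
  · exact canTransmit_two_Mad_of_large h

theorem mainTheorem1 (n : ℕ) (hn : 1 ≤ n) :
    IsGreatest {M : ℕ | CanTransmit (n - 1) n 1 M} (Mad n) ∧
      (3 ≤ n → CanTransmit 2 n 1 (Mad n)) := by
  refine ⟨⟨?_, fun M hM => hM.le_Mad hn⟩, canTransmit_two_Mad_of_three_le⟩
  rcases Nat.lt_or_ge n 3 with h | h
  -- Here `Mad n = 1`.
  · refine (canTransmit_of_le_one hn ?_).complete hn
    interval_cases n <;> decide
  · exact (canTransmit_two_Mad_of_three_le h).complete hn
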